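/- Let $p,q\ge 0$ and $0<r<1$ with $p+q+r=1$, and let $s\in[0,1]$. Let $(X_n)_{n\ge0}$ be the steps of an elephant random walk with stops: $X_0=0$; $P(X_1=1)=s$ and $P(X_1=-1)=1-s$; and, for every $n\ge 1$, conditionally on $X_1,\dots,X_n$, an integer $k$ is chosen uniformly at random in $\{1,\dots,n\}$ and $X_{n+1}$ equals $X_k$ with probability $p$, $-X_k$ with probability $q$, and $0$ with probability $r$. Let $S_0=0$ and $S_n=\sum_{k=1}^n X_k$ for $n\ge1$. Assume that $\frac{p}{1-r}>\frac34$. Then there is a real random variable $L$ which is non-degenerate (not almost surely equal to a constant) such that $$\lim_{n\to\infty}\frac{S_n}{n^{2p+r-1}}=L\quad\text{almost surely.}$$ Moreover, the convergence holds in $\mathbb{L}^m$ for every integer $m\ge1$: $\mathbb{E}[|L|^m]<\infty$ and $$\lim_{n\to\infty}\mathbb{E}\Bigl[\Bigl|\frac{S_n}{n^{2p+r-1}}-L\Bigr|^m\Bigr]=0.$$ -/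

import Mathlib

open MeasureTheory Filter Topology

noncomputable section

/-- Conditional probability that the next step equals `e` when the first `n` steps are
`x 1, …, x n`: a time `k` is chosen uniformly in `{1, …, n}`, and then the next step is
`x k` with probability `p`, `-x k` with probability `q` and `0` with probability `r`. -/
def erwsStepProb (p q r : ℝ) (n : ℕ) (x : ℕ → ℝ) (e : ℝ) : ℝ :=
  (1 / (n : ℝ)) * ∑ k ∈ Finset.Icc 1 n,
    (p * (if e = x k then 1 else 0) + q * (if e = -x k then 1 else 0)
      + r * (if e = 0 then 1 else 0))

/-- `X` is the sequence of steps of an elephant random walk with stops, with memory parameters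
`p, q, r` and first-step parameter `s`, on the probability space `(Ω, μ)`. The field `step` is
the multiplication rule `P(A ∩ B) = P(A) P(B | A)` for the past `A = {X 1 = x 1, …, X n = x n}`
and `B = {X (n + 1) = e}`. -/
structure IsERWS {Ω : Type*} [MeasurableSpace Ω] (μ : Measure Ω) (p q r s : ℝ)
    (X : ℕ → Ω → ℝ) : Prop where
  measurable : ∀ n, Measurable (X n)
  zero : ∀ ω, X 0 ω = 0
  first_pos : μ.real {ω | X 1 ω = 1} = s
  first_neg : μ.real {ω | X 1 ω = -1} = 1 - s
  step : ∀ n : ℕ, 1 ≤ n → ∀ (x : ℕ → ℝ) (e : ℝ),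
    μ.real {ω | (∀ k ∈ Finset.Icc 1 n, X k ω = x k) ∧ X (n + 1) ω = e} =
      μ.real {ω | ∀ k ∈ Finset.Icc 1 n, X k ω = x k} * erwsStepProb p q r n x e

/-- The position `S n = X 1 + ⋯ + X n` of the walk, with `S 0 = 0`. -/
def erwsPosition {Ω : Type*} (X : ℕ → Ω → ℝ) (n : ℕ) (ω : Ω) : ℝ :=
  ∑ k ∈ Finset.Icc 1 n, X k ω

end

/-! Write a = p - q, d = 1 - r, and let M_n be the number of nonzero steps up to time n. Given the
past, X_{n+1} has mean a S_n / n and second moment d M_n / n. Hence S_n divided by `erwsNorm a n`,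
which is asymptotic to a constant times n^a, is a martingale. Since E[M_n] has order n^d, its n-th
increment has variance of order n^(d-1-2a), summable exactly when d < 2a. As d = p + q, this is the
condition p / (1 - r) > 3/4.

All moments are controlled at once by an exponential supermartingale exp(x_n S_n + B x_n^2 M_n), x_n
= y / `erwsNorm a n`, whose M_n term pays for the fluctuations (`exists_quadratic_compensator`,
`integral_exp_succ_le`). Bounded moments of every order give almost sure convergence, uniform
integrability and hence convergence in every L^m. The martingale is therefore closed by its limit; a
constant limit would make every term constant, which the first two steps rule out. -/

/-! ### Finite path space and the one-step transition -/

/-- The possible values of a step. -/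
noncomputable def erwsValues : Finset ℝ := {-1, 0, 1}

lemma mem_erwsValues {e : ℝ} : e ∈ erwsValues ↔ e = -1 ∨ e = 0 ∨ e = 1 := by
  simp [erwsValues]

lemma sum_erwsValues (f : ℝ → ℝ) : ∑ e ∈ erwsValues, f e = f (-1) + f 0 + f 1 := by
  unfold erwsValues
  rw [Finset.sum_insert (by norm_num), Finset.sum_insert (by norm_num), Finset.sum_singleton]
  ring

/-- A finite set of representatives of the possible paths of length `n`. -/
lemma exists_finset_paths (n : ℕ) : ∃ T : Finset (ℕ → ℝ),
    (∀ x ∈ T, ∀ k ∈ Finset.Icc 1 n, x k ∈ erwsValues) ∧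
    ∀ y : ℕ → ℝ, (∀ k ∈ Finset.Icc 1 n, y k ∈ erwsValues) →
      ∃ x ∈ T, (∀ k ∈ Finset.Icc 1 n, y k = x k) ∧
        ∀ z ∈ T, (∀ k ∈ Finset.Icc 1 n, y k = z k) → z = x := by
  classical
  let extend : (Finset.Icc 1 n → ℝ) → ℕ → ℝ :=
    fun x k => if h : k ∈ Finset.Icc 1 n then x ⟨k, h⟩ else 0
  refine ⟨(Fintype.piFinset fun _ => erwsValues).image extend, ?_, fun y hy => ?_⟩
  · simp only [Finset.mem_image, Fintype.mem_piFinset]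
    rintro _ ⟨x, hx, rfl⟩ k hk
    simpa only [extend, dif_pos hk] using hx ⟨k, hk⟩
  · refine ⟨extend fun k : Finset.Icc 1 n => y k.1, Finset.mem_image_of_mem _ ?_,
      fun k hk => ?_, ?_⟩
    · exact Fintype.mem_piFinset.2 fun (k : Finset.Icc 1 n) => hy k.1 k.2
    · simp only [extend, dif_pos hk]
    · simp only [Finset.mem_image]
      rintro _ ⟨x, hx, rfl⟩ h
      exact congrArg extend (funext fun k => by
        simpa only [extend, dif_pos k.2] using (h k.1 k.2).symm)

/-- A function of the first `n` steps of a path represented in `T` is a finite combination of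
indicators. -/
lemma eq_sum_paths {n : ℕ} {T : Finset (ℕ → ℝ)} {y : ℕ → ℝ}
    (hT : ∃ x ∈ T, (∀ k ∈ Finset.Icc 1 n, y k = x k) ∧
        ∀ z ∈ T, (∀ k ∈ Finset.Icc 1 n, y k = z k) → z = x)
    {F : (ℕ → ℝ) → ℝ} (hF : DependsOn F (Finset.Icc 1 n : Set ℕ)) :
    F y = ∑ x ∈ T, Set.indicator {y : ℕ → ℝ | ∀ k ∈ Finset.Icc 1 n, y k = x k}
      (fun _ => F x) y := by
  classical
  obtain ⟨x, hxT, hx, huniq⟩ := hT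
  rw [Finset.sum_eq_single x]
  · rw [Set.indicator_of_mem (by exact hx)]
    exact hF fun k hk => hx k (by exact_mod_cast hk)
  · intro z hz hne
    rw [Set.indicator_of_notMem]
    exact fun h => hne (huniq z hz h)
  · exact fun h => (h hxT).elim

/-- Any function on {-1, 0, 1} is a quadratic polynomial, so the transition sees the past only
through the sum of the steps (odd part of `g`) and the sum of their squares (even part). -/
lemma erwsStepProb_sum {p q r : ℝ} {n : ℕ} {x : ℕ → ℝ}
    (hn : 1 ≤ n) (hpqr : p + q + r = 1) (hx : ∀ k ∈ Finset.Icc 1 n, x k ∈ erwsValues)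
    (g : ℝ → ℝ) :
    ∑ e ∈ erwsValues, g e * erwsStepProb p q r n x e =
      g 0 + (p - q) * (∑ k ∈ Finset.Icc 1 n, x k) / n * ((g 1 - g (-1)) / 2) +
        (1 - r) * (∑ k ∈ Finset.Icc 1 n, x k ^ 2) / n * ((g 1 + g (-1)) / 2 - g 0) := by
  have hn0 : (n : ℝ) ≠ 0 := by positivity
  have h1 : ∀ k ∈ Finset.Icc 1 n, ∑ e ∈ erwsValues, g e * (p * (if e = x k then 1 else 0) +
      q * (if e = -x k then 1 else 0) + r * (if e = 0 then 1 else 0)) =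
      g 0 + (p - q) * ((g 1 - g (-1)) / 2) * x k +
        (1 - r) * ((g 1 + g (-1)) / 2 - g 0) * x k ^ 2 := by
    intro k hk
    have hr : r = 1 - p - q := by linarith
    rw [sum_erwsValues]
    rcases mem_erwsValues.1 (hx k hk) with h | h | h <;> rw [h] <;> norm_num <;> subst hr <;> ring
  have h2 : ∑ e ∈ erwsValues, g e * erwsStepProb p q r n x e =
      1 / n * ∑ k ∈ Finset.Icc 1 n, ∑ e ∈ erwsValues, g e * (p * (if e = x k then 1 else 0) +
      q * (if e = -x k then 1 else 0) + r * (if e = 0 then 1 else 0)) := by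
    rw [Finset.sum_comm, Finset.mul_sum]
    refine Finset.sum_congr rfl fun e _ => ?_
    rw [erwsStepProb, ← Finset.mul_sum]
    ring
  rw [h2, Finset.sum_congr rfl h1, Finset.sum_add_distrib, Finset.sum_add_distrib,
    ← Finset.mul_sum, ← Finset.mul_sum, Finset.sum_const, Nat.card_Icc, Nat.add_sub_cancel,
    nsmul_eq_mul]
  field_simp

namespace IsERWS

variable {Ω : Type*} [MeasurableSpace Ω] {μ : Measure Ω} {p q r s : ℝ} {X : ℕ → Ω → ℝ}

lemma measurableSet_past (hX : IsERWS μ p q r s X) (n : ℕ) (x : ℕ → ℝ) :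
    MeasurableSet {ω | ∀ k ∈ Finset.Icc 1 n, X k ω = x k} := by
  have : {ω | ∀ k ∈ Finset.Icc 1 n, X k ω = x k} =
      ⋂ k ∈ Finset.Icc 1 n, X k ⁻¹' {x k} := by
    ext ω; simp
  rw [this]
  exact Finset.measurableSet_biInter _ fun k _ => hX.measurable k (measurableSet_singleton _)

lemma measurableSet_step (hX : IsERWS μ p q r s X) (n : ℕ) (x : ℕ → ℝ) (e : ℝ) :
    MeasurableSet {ω | (∀ k ∈ Finset.Icc 1 n, X k ω = x k) ∧ X (n + 1) ω = e} :=
  (hX.measurableSet_past n x).inter (hX.measurable _ (measurableSet_singleton e))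

/-- Expectation of a function of the first `n` steps as a finite sum. -/
lemma integral_past [IsProbabilityMeasure μ] (hX : IsERWS μ p q r s X) {n : ℕ}
    {T : Finset (ℕ → ℝ)}
    (hT : ∀ y : ℕ → ℝ, (∀ k ∈ Finset.Icc 1 n, y k ∈ erwsValues) →
      ∃ x ∈ T, (∀ k ∈ Finset.Icc 1 n, y k = x k) ∧
        ∀ z ∈ T, (∀ k ∈ Finset.Icc 1 n, y k = z k) → z = x)
    (hval : ∀ᵐ ω ∂μ, ∀ k ∈ Finset.Icc 1 n, X k ω ∈ erwsValues)
    {F : (ℕ → ℝ) → ℝ} (hF : DependsOn F (Finset.Icc 1 n : Set ℕ)) :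
    ∫ ω, F (fun k => X k ω) ∂μ =
      ∑ x ∈ T, μ.real {ω | ∀ k ∈ Finset.Icc 1 n, X k ω = x k} * F x := by
  have h1 : ∀ᵐ ω ∂μ, F (fun k => X k ω) = ∑ x ∈ T,
      Set.indicator {ω | ∀ k ∈ Finset.Icc 1 n, X k ω = x k} (fun _ => F x) ω := by
    filter_upwards [hval] with ω hω
    exact eq_sum_paths (y := fun k => X k ω) (hT _ hω) hF
  rw [integral_congr_ae h1, integral_finsetSum]
  · refine Finset.sum_congr rfl fun x _ => ?_
    rw [integral_indicator_const _ (hX.measurableSet_past n x), smul_eq_mul]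
  · exact fun x _ => (integrable_const _).indicator (hX.measurableSet_past n x)

/-- Almost surely every step is `-1`, `0` or `1`. -/
lemma ae_mem_values_of_le [IsProbabilityMeasure μ] (hX : IsERWS μ p q r s X)
    (hpqr : p + q + r = 1) (n : ℕ) :
    ∀ᵐ ω ∂μ, ∀ k ∈ Finset.Icc 1 n, X k ω ∈ erwsValues := by
  induction n with
  | zero => simp
  | succ n ih =>
    have key : ∀ᵐ ω ∂μ, X (n + 1) ω ∈ erwsValues := by
      have hE : MeasurableSet {ω | X (n + 1) ω ∈ erwsValues} :=
        hX.measurable _ erwsValues.measurableSet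
      -- The support is not assumed: it follows because the prescribed masses of the values -1, 0, 1
      -- already add up to 1.
      suffices μ.real {ω | X (n + 1) ω ∈ erwsValues} = 1 by
        refine (mem_ae_iff_prob_eq_one hE).2 ?_
        rwa [measureReal_def, ENNReal.toReal_eq_one_iff] at this
      rcases Nat.eq_zero_or_pos n with rfl | hn
      · refine le_antisymm measureReal_le_one ?_
        have hd : Disjoint {ω | X 1 ω = 1} {ω | X 1 ω = -1} := by
          rw [Set.disjoint_left]
          intro ω (h1 : X 1 ω = 1) (h2 : X 1 ω = -1)
          linarith
        have := measureReal_union (μ := μ) hd (hX.measurable 1 (measurableSet_singleton (-1)))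
        rw [hX.first_pos, hX.first_neg, add_sub_cancel] at this
        rw [← this]
        refine measureReal_mono ?_
        rintro ω (h | h) <;> simp_all [mem_erwsValues]
      · obtain ⟨T, hTv, hT⟩ := exists_finset_paths n
        have h1 : ∀ᵐ ω ∂μ, Set.indicator {ω | X (n + 1) ω ∈ erwsValues} (fun _ => (1 : ℝ)) ω =
            ∑ x ∈ T, ∑ e ∈ erwsValues, Set.indicator
              {ω | (∀ k ∈ Finset.Icc 1 n, X k ω = x k) ∧ X (n + 1) ω = e} (fun _ => (1 : ℝ)) ω := by
          classical
          filter_upwards [ih] with ω hω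
          -- `F` ignores the path here, so the path indicators act as a partition of unity.
          have := eq_sum_paths (y := fun k => X k ω) (hT _ hω)
            (F := fun _ => Set.indicator {ω | X (n + 1) ω ∈ erwsValues} (fun _ => (1 : ℝ)) ω)
            (fun _ _ _ => rfl)
          rw [this]
          refine Finset.sum_congr rfl fun x _ => ?_
          simp only [Set.indicator_apply, Set.mem_ofPred_eq]
          by_cases hx : ∀ k ∈ Finset.Icc 1 n, X k ω = x k
          · simp only [if_pos hx, and_iff_right hx]; simp
          · rw [if_neg hx]; exact (Finset.sum_eq_zero fun e _ => if_neg fun h => hx h.1).symm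
        have h2 := integral_congr_ae h1
        rw [integral_indicator_const _ hE, integral_finsetSum _ (fun x _ => integrable_finsetSum _
          fun e _ => (integrable_const _).indicator (hX.measurableSet_step n x e))] at h2
        simp_rw [integral_finsetSum _ (fun e _ => (integrable_const (1 : ℝ)).indicator
          (hX.measurableSet_step n _ e)),
          integral_indicator_const _ (hX.measurableSet_step n _ _), hX.step n hn,
          smul_eq_mul, mul_one, ← Finset.mul_sum] at h2
        have h3 : ∫ _, (1 : ℝ) ∂μ = 1 := by simp
        rw [h2, ← h3, hX.integral_past hT ih (F := fun _ => 1) (fun _ _ _ => rfl)]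
        refine Finset.sum_congr rfl fun x hx => ?_
        have := erwsStepProb_sum hn hpqr (hTv x hx) (fun _ => 1)
        simp only [one_mul] at this
        rw [this]
        norm_num
    filter_upwards [ih, key] with ω h1 h2 k hk
    rcases Nat.lt_or_ge n k with h | h
    · have : k = n + 1 := le_antisymm (Finset.mem_Icc.1 hk).2 h
      rwa [this]
    · exact h1 k (Finset.mem_Icc.2 ⟨(Finset.mem_Icc.1 hk).1, h⟩)

lemma ae_mem_values [IsProbabilityMeasure μ] (hX : IsERWS μ p q r s X)
    (hpqr : p + q + r = 1) :
    ∀ᵐ ω ∂μ, ∀ k, X k ω ∈ erwsValues := by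
  filter_upwards [ae_all_iff.2 (hX.ae_mem_values_of_le hpqr)] with ω h k
  rcases Nat.eq_zero_or_pos k with rfl | hk
  · rw [hX.zero]; simp [mem_erwsValues]
  · exact h k k (Finset.mem_Icc.2 ⟨hk, le_rfl⟩)

/-- The one-step transition: conditional expectation of `g (X (n + 1))` given the past. -/
lemma integral_mul_step [IsProbabilityMeasure μ] (hX : IsERWS μ p q r s X)
    (hpqr : p + q + r = 1) {n : ℕ} (hn : 1 ≤ n) {F : (ℕ → ℝ) → ℝ}
    (hF : DependsOn F (Finset.Icc 1 n : Set ℕ)) (g : ℝ → ℝ) :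
    ∫ ω, F (fun k => X k ω) * g (X (n + 1) ω) ∂μ =
      ∫ ω, F (fun k => X k ω) * (g 0 +
        (p - q) * (∑ k ∈ Finset.Icc 1 n, X k ω) / n * ((g 1 - g (-1)) / 2) +
        (1 - r) * (∑ k ∈ Finset.Icc 1 n, X k ω ^ 2) / n * ((g 1 + g (-1)) / 2 - g 0)) ∂μ := by
  classical
  obtain ⟨T, hTv, hT⟩ := exists_finset_paths n
  have hval := hX.ae_mem_values_of_le hpqr n
  rw [hX.integral_past hT hval (F := fun x => F x * (g 0 +
        (p - q) * (∑ k ∈ Finset.Icc 1 n, x k) / n * ((g 1 - g (-1)) / 2) +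
        (1 - r) * (∑ k ∈ Finset.Icc 1 n, x k ^ 2) / n * ((g 1 + g (-1)) / 2 - g 0)))]
  · have h1 : ∀ᵐ ω ∂μ, F (fun k => X k ω) * g (X (n + 1) ω) =
            ∑ x ∈ T, ∑ e ∈ erwsValues, Set.indicator
              {ω | (∀ k ∈ Finset.Icc 1 n, X k ω = x k) ∧ X (n + 1) ω = e}
              (fun _ => F x * g e) ω := by
      filter_upwards [hX.ae_mem_values hpqr] with ω hω
      have := eq_sum_paths (y := fun k => X k ω) (hT _ fun k _ => hω k)
        (F := fun x => F x * g (X (n + 1) ω)) (fun x y h => by simp only [hF h])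
      rw [this]
      refine Finset.sum_congr rfl fun x _ => ?_
      simp only [Set.indicator_apply, Set.mem_ofPred_eq]
      by_cases hx : ∀ k ∈ Finset.Icc 1 n, X k ω = x k
      · simp only [if_pos hx, and_iff_right hx]; simp [hω (n + 1)]
      · rw [if_neg hx]; exact (Finset.sum_eq_zero fun e _ => if_neg fun h => hx h.1).symm
    rw [integral_congr_ae h1, integral_finsetSum _ (fun x _ => integrable_finsetSum _
          fun e _ => (integrable_const _).indicator (hX.measurableSet_step n x e))]
    refine Finset.sum_congr rfl fun x hx => ?_
    rw [integral_finsetSum _ (fun e _ => (integrable_const _).indicator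
          (hX.measurableSet_step n _ e)), ← erwsStepProb_sum hn hpqr (hTv x hx) g,
          Finset.mul_sum, Finset.mul_sum]
    refine Finset.sum_congr rfl fun e _ => ?_
    rw [integral_indicator_const _ (hX.measurableSet_step n _ _), hX.step n hn, smul_eq_mul]
    ring
  · intro x y h
    have h' : ∀ k ∈ Finset.Icc 1 n, x k = y k := fun k hk => h k (by exact_mod_cast hk)
    simp only
    have h2 : ∑ k ∈ Finset.Icc 1 n, x k ^ 2 = ∑ k ∈ Finset.Icc 1 n, y k ^ 2 :=
      Finset.sum_congr rfl fun k hk => by rw [h' k hk]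
    rw [hF h, Finset.sum_congr rfl h', h2]

end IsERWS

/-! ### Hyperbolic inequalities for the compensator -/

lemma Real.sinh_le_mul_cosh {x : ℝ} (hx : 0 ≤ x) : Real.sinh x ≤ x * Real.cosh x := by
  have h : MonotoneOn (fun y : ℝ => y * Real.cosh y - Real.sinh y) (Set.Ici 0) := by
    refine monotoneOn_of_deriv_nonneg (convex_Ici 0) (by fun_prop) (by fun_prop) fun y hy => ?_
    rw [interior_Ici] at hy
    have : HasDerivAt (fun y : ℝ => y * Real.cosh y - Real.sinh y)
        (1 * Real.cosh y + y * Real.sinh y - Real.cosh y) y :=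
      ((hasDerivAt_id y).mul (Real.hasDerivAt_cosh y)).sub (Real.hasDerivAt_sinh y)
    rw [this.deriv, one_mul, add_sub_cancel_left]
    exact mul_nonneg hy.le (Real.sinh_nonneg_iff.2 hy.le)
  have := h (Set.self_mem_Ici) hx hx
  simp only [zero_mul, Real.sinh_zero, sub_zero] at this
  linarith

/-- Makes the error of the odd part smaller than that of the even part by a factor |x|, hence of
third order when ν is of order x^2. -/
lemma Real.abs_exp_mul_sinh_sub_le {x ν : ℝ} (hν : 0 ≤ ν) :
    |Real.exp ν * Real.sinh x - x| ≤ |x| * (Real.exp ν * Real.cosh x - 1) := by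
  have key : ∀ y : ℝ, 0 ≤ y →
      |Real.exp ν * Real.sinh y - y| ≤ y * (Real.exp ν * Real.cosh y - 1) := by
    intro y hy
    have h1 : y ≤ Real.sinh y := Real.self_le_sinh_iff.2 hy
    have h2 := Real.sinh_le_mul_cosh hy
    have h3 : 1 ≤ Real.exp ν := Real.one_le_exp hν
    rw [abs_of_nonneg (by nlinarith)]
    nlinarith
  rcases le_total 0 x with hx | hx
  · rw [abs_of_nonneg hx]; exact key x hx
  · have := key (-x) (by linarith)
    rw [Real.sinh_neg, Real.cosh_neg] at this
    rw [abs_of_nonpos hx]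
    refine le_trans (le_of_eq ?_) this
    rw [← abs_neg]; congr 1; ring

/-- The local inequality behind the exponential supermartingale. -/
lemma exists_quadratic_compensator {a d : ℝ} (ha : 0 < a) (hd : 0 < d) (had : d < 2 * a) :
    ∃ B t₀ : ℝ, 0 < B ∧ 0 < t₀ ∧ ∀ x : ℝ, |x| ≤ t₀ →
      d * (Real.exp (B * x ^ 2) * Real.cosh x - 1) +
        a * |Real.exp (B * x ^ 2) * Real.sinh x - x| ≤ 2 * a * (B * x ^ 2) := by
  have hs : 0 < 2 * a - d := by linarith
  -- To second order the left side is d (B + 1/2) x^2, so the critical value is d / (2 (2a - d)).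
  -- Twice that value leaves a surplus d x^2 / 2, which absorbs the higher-order terms for small
  -- |x|.
  obtain ⟨B, hB⟩ : ∃ B, B = d / (2 * a - d) := ⟨_, rfl⟩
  have hBpos : 0 < B := hB ▸ div_pos hd hs
  have hBd : (2 * a - d) * B = d := by rw [hB]; field_simp
  obtain ⟨b, hb⟩ : ∃ b, b = B + 1 / 2 := ⟨_, rfl⟩
  have hbpos : 0 < b := by linarith
  have hc : 0 < (d * b + 2 * a) * b := by positivity
  refine ⟨B, min 1 (min (1 / b) (d / 2 / ((d * b + 2 * a) * b))), hBpos, by positivity,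
    fun x hx => ?_⟩
  have hx1 : |x| ≤ 1 := hx.trans (min_le_left _ _)
  have hx2 : |x| * b ≤ 1 := by
    have := hx.trans ((min_le_right _ _).trans (min_le_left _ _))
    rwa [le_div_iff₀ hbpos] at this
  have hx3 : |x| * ((d * b + 2 * a) * b) ≤ d / 2 := by
    have := hx.trans ((min_le_right _ _).trans (min_le_right _ _))
    rwa [le_div_iff₀ hc] at this
  have hx0 := abs_nonneg x
  have hsq : x ^ 2 = |x| ^ 2 := (sq_abs x).symm
  obtain ⟨u, hu⟩ : ∃ u, u = b * x ^ 2 := ⟨_, rfl⟩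
  have hu0 : 0 ≤ u := by rw [hu]; positivity
  have hux : u ≤ b * |x| := by
    rw [hu, hsq]
    exact mul_le_mul_of_nonneg_left (by nlinarith) hbpos.le
  have hu1 : u ≤ 1 := by linarith
  have hcosh : Real.exp (B * x ^ 2) * Real.cosh x - 1 ≤ u + u ^ 2 := by
    have h1 : Real.exp (B * x ^ 2) * Real.cosh x ≤ Real.exp u := by
      calc _ ≤ Real.exp (B * x ^ 2) * Real.exp (x ^ 2 / 2) := by
            gcongr; exact Real.cosh_le_exp_half_sq x
        _ = Real.exp u := by rw [← Real.exp_add, hu, hb]; congr 1; ring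
    have h2 := Real.abs_exp_sub_one_sub_id_le (x := u) (by rwa [abs_of_nonneg hu0])
    have := (abs_le.1 h2).2
    linarith
  have hsinh := Real.abs_exp_mul_sinh_sub_le (x := x) (ν := B * x ^ 2) (by positivity)
  have hsinh' : |Real.exp (B * x ^ 2) * Real.sinh x - x| ≤ |x| * (2 * u) :=
    hsinh.trans (mul_le_mul_of_nonneg_left (by nlinarith) hx0)
  have e1 := mul_le_mul_of_nonneg_left hcosh hd.le
  have e2 := mul_le_mul_of_nonneg_left hsinh' ha.le
  have e3 : d * (u + u ^ 2) + a * (|x| * (2 * u)) ≤ d * u + (d * b + 2 * a) * |x| * u := by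
    nlinarith [mul_le_mul_of_nonneg_left hux (mul_nonneg hd.le hu0)]
  have e4 : (d * b + 2 * a) * |x| * u ≤ d / 2 * x ^ 2 := by
    rw [hu]
    nlinarith [mul_le_mul_of_nonneg_right hx3 (sq_nonneg x)]
  have e5 : d * u + d / 2 * x ^ 2 = 2 * a * (B * x ^ 2) := by
    rw [hu, hb]; linear_combination (-x ^ 2) * hBd
  linarith

/-! ### Asymptotics of the normalization -/

/-- The normalization `∏_{k=1}^{n-1} (1 + a / k)` of the walk. -/
noncomputable def erwsNorm (a : ℝ) (n : ℕ) : ℝ := ∏ k ∈ Finset.Ico 1 n, (1 + a / k)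

lemma erwsNorm_one (a : ℝ) : erwsNorm a 1 = 1 := by simp [erwsNorm]

lemma erwsNorm_succ (a : ℝ) {n : ℕ} (hn : 1 ≤ n) :
    erwsNorm a (n + 1) = erwsNorm a n * (1 + a / n) := by
  rw [erwsNorm, Finset.prod_Ico_succ_top hn, erwsNorm]

lemma one_le_erwsNorm {a : ℝ} (ha : 0 ≤ a) (n : ℕ) : 1 ≤ erwsNorm a n :=
  Finset.prod_induction _ (fun x => 1 ≤ x) (fun _ _ => one_le_mul_of_one_le_of_one_le) le_rfl
    fun _ _ => le_add_of_nonneg_right (by positivity)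

lemma erwsNorm_pos {a : ℝ} (ha : 0 ≤ a) (n : ℕ) : 0 < erwsNorm a n :=
  zero_lt_one.trans_le (one_le_erwsNorm ha n)

/-- Clearing denominators turns the product into a (a + 1) ⋯ (a + n) / (a n!), and Euler's sequence
for Γ(a) has the same rising factorial in its denominator. -/
lemma erwsNorm_succ_eq_gammaSeq {a : ℝ} (ha : 0 < a) (n : ℕ) (hn : 1 ≤ n) :
    erwsNorm a (n + 1) = (n : ℝ) ^ a / (a * Real.GammaSeq a n) := by
  have h : ∀ n : ℕ, erwsNorm a (n + 1) * (a * n.factorial) =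
      ∏ j ∈ Finset.range (n + 1), (a + j) := by
    intro n
    induction n with
    | zero => simp [erwsNorm]
    | succ n ih =>
      rw [Finset.prod_range_succ, ← ih, erwsNorm_succ a (Nat.le_add_left 1 n),
        Nat.factorial_succ]
      push_cast
      field_simp
      ring
  have hpos : 0 < ∏ j ∈ Finset.range (n + 1), (a + j) :=
    Finset.prod_pos fun j _ => by positivity
  have hn' : (0 : ℝ) < (n : ℝ) ^ a := Real.rpow_pos_of_pos (by exact_mod_cast hn) _
  have hf : (0 : ℝ) < n.factorial := by exact_mod_cast n.factorial_pos
  rw [Real.GammaSeq, eq_div_iff (by positivity), ← h n]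
  have := erwsNorm_pos ha.le (n + 1)
  field_simp

lemma tendsto_erwsNorm_div_rpow {a : ℝ} (ha : 0 < a) :
    Tendsto (fun n : ℕ => erwsNorm a n / (n : ℝ) ^ a) atTop (𝓝 (a * Real.Gamma a)⁻¹) := by
  have h1 : Tendsto (fun n : ℕ => (a * Real.GammaSeq a n)⁻¹ * (1 + a / n)⁻¹) atTop
      (𝓝 ((a * Real.Gamma a)⁻¹ * (1 + 0)⁻¹)) :=
    (((Real.GammaSeq_tendsto_Gamma a).const_mul a).inv₀
      (mul_pos ha (Real.Gamma_pos_of_pos ha)).ne').mul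
      (((tendsto_const_div_atTop_nhds_zero_nat a).const_add 1).inv₀ (by norm_num))
  rw [add_zero, inv_one, mul_one] at h1
  refine h1.congr' ?_
  filter_upwards [eventually_ge_atTop 1] with n hn
  have hn' : (0 : ℝ) < (n : ℝ) ^ a := Real.rpow_pos_of_pos (by exact_mod_cast hn) _
  have h2 := erwsNorm_succ a hn
  have h3 := erwsNorm_succ_eq_gammaSeq ha n hn
  have h4 : (0 : ℝ) < 1 + a / n := by positivity
  have h5 : erwsNorm a n = (n : ℝ) ^ a / (a * Real.GammaSeq a n) / (1 + a / n) := by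
    rw [eq_div_iff h4.ne', ← h2, h3]
  rw [h5]
  field_simp

/-! ### Exponential supermartingale and moment bounds -/

lemma abs_le_one_of_mem_erwsValues {e : ℝ} (he : e ∈ erwsValues) : |e| ≤ 1 := by
  rcases mem_erwsValues.1 he with h | h | h <;> simp [h]

lemma sq_eq_abs_of_mem_erwsValues {e : ℝ} (he : e ∈ erwsValues) : e ^ 2 = |e| := by
  rcases mem_erwsValues.1 he with h | h | h <;> simp [h]

/-- The number of steps among the first `n` at which the walk moves. -/
noncomputable def erwsMoves {Ω : Type*} (X : ℕ → Ω → ℝ) (n : ℕ) (ω : Ω) : ℝ :=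
  ∑ k ∈ Finset.Icc 1 n, X k ω ^ 2

lemma erwsPosition_succ {Ω : Type*} (X : ℕ → Ω → ℝ) (n : ℕ) (ω : Ω) :
    erwsPosition X (n + 1) ω = erwsPosition X n ω + X (n + 1) ω :=
  Finset.sum_Icc_succ_top (Nat.le_add_left 1 n) _

lemma erwsMoves_succ {Ω : Type*} (X : ℕ → Ω → ℝ) (n : ℕ) (ω : Ω) :
    erwsMoves X (n + 1) ω = erwsMoves X n ω + X (n + 1) ω ^ 2 :=
  Finset.sum_Icc_succ_top (Nat.le_add_left 1 n) _

lemma abs_erwsPosition_le {Ω : Type*} {X : ℕ → Ω → ℝ} {n : ℕ} {ω : Ω}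
    (hω : ∀ k, X k ω ∈ erwsValues) :
    |erwsPosition X n ω| ≤ erwsMoves X n ω :=
  (Finset.abs_sum_le_sum_abs _ _).trans
    (Finset.sum_le_sum fun k _ => (sq_eq_abs_of_mem_erwsValues (hω k)).ge)

lemma erwsMoves_le {Ω : Type*} {X : ℕ → Ω → ℝ} {n : ℕ} {ω : Ω}
    (hω : ∀ k, X k ω ∈ erwsValues) : erwsMoves X n ω ≤ n := by
  have : ∀ k ∈ Finset.Icc 1 n, X k ω ^ 2 ≤ 1 := fun k _ =>
    (sq_eq_abs_of_mem_erwsValues (hω k)).trans_le (abs_le_one_of_mem_erwsValues (hω k))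
  simpa [erwsMoves] using Finset.sum_le_sum this

lemma erwsMoves_nonneg {Ω : Type*} {X : ℕ → Ω → ℝ} (n : ℕ) (ω : Ω) : 0 ≤ erwsMoves X n ω :=
  Finset.sum_nonneg fun _ _ => sq_nonneg _

namespace IsERWS

variable {Ω : Type*} [MeasurableSpace Ω] {μ : Measure Ω} {p q r s : ℝ} {X : ℕ → Ω → ℝ}

lemma measurable_position (hX : IsERWS μ p q r s X) (n : ℕ) : Measurable (erwsPosition X n) :=
  Finset.measurable_sum _ fun k _ => hX.measurable k

lemma measurable_moves (hX : IsERWS μ p q r s X) (n : ℕ) : Measurable (erwsMoves X n) :=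
  Finset.measurable_sum _ fun k _ => (hX.measurable k).pow_const 2

lemma integrable_exp [IsProbabilityMeasure μ] (hX : IsERWS μ p q r s X) (hpqr : p + q + r = 1)
    (n : ℕ) (x ν : ℝ) :
    Integrable (fun ω => Real.exp (x * erwsPosition X n ω + ν * erwsMoves X n ω)) μ := by
  refine Integrable.of_bound (C := Real.exp (|x| * n + |ν| * n))
    (((hX.measurable_position n).const_mul x).add
      ((hX.measurable_moves n).const_mul ν)).exp.aestronglyMeasurable ?_
  filter_upwards [hX.ae_mem_values hpqr] with ω hω
  rw [Real.norm_eq_abs, Real.abs_exp, Real.exp_le_exp]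
  have h1 := abs_erwsPosition_le (n := n) hω
  have h2 := erwsMoves_le (n := n) hω
  have h3 := erwsMoves_nonneg (X := X) n ω
  refine add_le_add ((le_abs_self _).trans ?_) ((le_abs_self _).trans ?_) <;> rw [abs_mul]
  · exact mul_le_mul_of_nonneg_left (h1.trans h2) (abs_nonneg _)
  · rw [abs_of_nonneg h3]; exact mul_le_mul_of_nonneg_left h2 (abs_nonneg _)

/-- One step of the exponential supermartingale. -/
lemma integral_exp_succ_le [IsProbabilityMeasure μ] (hX : IsERWS μ p q r s X)
    (hpqr : p + q + r = 1) {n : ℕ} (hn : 1 ≤ n) {x ν x' ν' : ℝ} (ha : 0 ≤ p - q)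
    (hx : x = x' * (1 + (p - q) / n))
    (hν : n * (ν - ν') ≥ (1 - r) * (Real.exp ν' * Real.cosh x' - 1) +
        (p - q) * |Real.exp ν' * Real.sinh x' - x'|) :
    ∫ ω, Real.exp (x' * erwsPosition X (n + 1) ω + ν' * erwsMoves X (n + 1) ω) ∂μ ≤
      ∫ ω, Real.exp (x * erwsPosition X n ω + ν * erwsMoves X n ω) ∂μ := by
  have hn0 : (0 : ℝ) < n := by exact_mod_cast hn
  have h1 := hX.integral_mul_step hpqr hn (F := fun y => Real.exp
    (x' * (∑ k ∈ Finset.Icc 1 n, y k) + ν' * (∑ k ∈ Finset.Icc 1 n, y k ^ 2))) (by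
      intro y z h
      have h' : ∀ k ∈ Finset.Icc 1 n, y k = z k := fun k hk => h k (by exact_mod_cast hk)
      have h2 : ∑ k ∈ Finset.Icc 1 n, y k ^ 2 = ∑ k ∈ Finset.Icc 1 n, z k ^ 2 :=
        Finset.sum_congr rfl fun k hk => by rw [h' k hk]
      simp only
      rw [Finset.sum_congr rfl h', h2]) (fun e => Real.exp (x' * e + ν' * e ^ 2))
  have h2 : ∀ ω, Real.exp (x' * erwsPosition X (n + 1) ω + ν' * erwsMoves X (n + 1) ω) =
      Real.exp (x' * (∑ k ∈ Finset.Icc 1 n, X k ω) + ν' * (∑ k ∈ Finset.Icc 1 n, X k ω ^ 2)) *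
        Real.exp (x' * X (n + 1) ω + ν' * X (n + 1) ω ^ 2) := by
    intro ω
    rw [erwsPosition_succ, erwsMoves_succ, ← Real.exp_add, erwsPosition, erwsMoves]
    congr 1; ring
  simp_rw [h2]
  rw [h1]
  -- Without integrability the left integral is 0 by convention and the bound is trivial, so
  -- integrability need not be proved.
  by_cases hint : Integrable (fun ω => Real.exp (x' * (∑ k ∈ Finset.Icc 1 n, X k ω) +
      ν' * (∑ k ∈ Finset.Icc 1 n, X k ω ^ 2)) * (Real.exp (x' * 0 + ν' * 0 ^ 2) +
        (p - q) * (∑ k ∈ Finset.Icc 1 n, X k ω) / n *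
          ((Real.exp (x' * 1 + ν' * 1 ^ 2) - Real.exp (x' * (-1) + ν' * (-1) ^ 2)) / 2) +
        (1 - r) * (∑ k ∈ Finset.Icc 1 n, X k ω ^ 2) / n *
          ((Real.exp (x' * 1 + ν' * 1 ^ 2) + Real.exp (x' * (-1) + ν' * (-1) ^ 2)) / 2 -
            Real.exp (x' * 0 + ν' * 0 ^ 2)))) μ
  swap
  · rw [integral_undef hint]
    exact integral_nonneg fun ω => (Real.exp_pos _).le
  refine integral_mono_ae hint (hX.integrable_exp hpqr n x ν) ?_
  filter_upwards [hX.ae_mem_values hpqr] with ω hω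
  have hS := abs_erwsPosition_le (n := n) hω
  have hM := erwsMoves_nonneg (X := X) n ω
  change Real.exp (x' * erwsPosition X n ω + ν' * erwsMoves X n ω) * (_ +
    (p - q) * erwsPosition X n ω / n * _ + (1 - r) * erwsMoves X n ω / n * _) ≤ _
  generalize erwsPosition X n ω = S at *
  generalize erwsMoves X n ω = M at *
  have e0 : Real.exp (x' * 0 + ν' * 0 ^ 2) = 1 := by simp
  have e1 : (Real.exp (x' * 1 + ν' * 1 ^ 2) - Real.exp (x' * (-1) + ν' * (-1) ^ 2)) / 2 =
      Real.exp ν' * Real.sinh x' := by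
    rw [Real.exp_add, Real.exp_add, Real.sinh_eq]; norm_num; ring
  have e2 : (Real.exp (x' * 1 + ν' * 1 ^ 2) + Real.exp (x' * (-1) + ν' * (-1) ^ 2)) / 2 =
      Real.exp ν' * Real.cosh x' := by
    rw [Real.exp_add, Real.exp_add, Real.cosh_eq]; norm_num; ring
  rw [e0, e1, e2]
  generalize Real.exp ν' * Real.sinh x' = σ at *
  generalize Real.exp ν' * Real.cosh x' = κ at *
  have h3 := Real.add_one_le_exp ((p - q) * S / n * σ + (1 - r) * M / n * (κ - 1))
  -- The term linear in S cancels exactly through `hx`; its error is charged to M because |S| ≤ M,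
  -- which leaves the condition `hν`.
  have h4 : S * (σ - x') ≤ M * |σ - x'| :=
    (le_abs_self _).trans ((abs_mul _ _).trans_le (mul_le_mul_of_nonneg_right hS (abs_nonneg _)))
  calc _ ≤ Real.exp (x' * S + ν' * M) *
        Real.exp ((p - q) * S / n * σ + (1 - r) * M / n * (κ - 1)) := by
        refine mul_le_mul_of_nonneg_left ?_ (Real.exp_pos _).le
        linarith
    _ ≤ Real.exp (x * S + ν * M) := by
        rw [← Real.exp_add, Real.exp_le_exp, hx, ← sub_nonneg]
        have h5 := mul_le_mul_of_nonneg_left h4 ha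
        have h6 := mul_le_mul_of_nonneg_left hν.le hM
        have h7 : x' * (1 + (p - q) / n) * S + ν * M - (x' * S + ν' * M +
            ((p - q) * S / n * σ + (1 - r) * M / n * (κ - 1))) =
            (M * (n * (ν - ν')) - M * ((1 - r) * (κ - 1)) - (p - q) * (S * (σ - x'))) / n := by
          field_simp; ring
        rw [h7]
        refine div_nonneg ?_ hn0.le
        linarith

/-- Exponential moments of the normalized walk are bounded. -/
lemma exists_exp_moment_bound [IsProbabilityMeasure μ] (hX : IsERWS μ p q r s X)
    (hpqr : p + q + r = 1) (ha : 0 < p - q) (hr : r < 1) (had : 1 - r < 2 * (p - q)) :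
    ∃ t C : ℝ, 0 < t ∧ ∀ n : ℕ, 1 ≤ n → ∀ y : ℝ, |y| ≤ t →
      ∫ ω, Real.exp (y * (erwsPosition X n ω / erwsNorm (p - q) n)) ∂μ ≤ C := by
  obtain ⟨B, t, hB, ht, h⟩ := exists_quadratic_compensator ha (sub_pos.2 hr) had
  -- This constant bounds the exponential at time 1, where |S| and M are at most 1; the
  -- supermartingale property propagates it.
  refine ⟨t, Real.exp (t + B * t ^ 2), ht, fun n hn y hy => ?_⟩
  have hpos := fun n => erwsNorm_pos ha.le n
  have hmono : ∀ n : ℕ, 1 ≤ n → ∫ ω, Real.exp (y / erwsNorm (p - q) n * erwsPosition X n ω +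
      B * (y / erwsNorm (p - q) n) ^ 2 * erwsMoves X n ω) ∂μ ≤ Real.exp (t + B * t ^ 2) := by
    intro n hn
    induction n, hn using Nat.le_induction with
    | base =>
      have hle : ∀ᵐ ω ∂μ, Real.exp (y / erwsNorm (p - q) 1 * erwsPosition X 1 ω +
          B * (y / erwsNorm (p - q) 1) ^ 2 * erwsMoves X 1 ω) ≤ Real.exp (t + B * t ^ 2) := by
        filter_upwards [hX.ae_mem_values hpqr] with ω hω
        have h1 := abs_erwsPosition_le (n := 1) hω
        have h2 := erwsMoves_le (n := 1) hω
        rw [Nat.cast_one] at h2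
        rw [Real.exp_le_exp, erwsNorm_one, div_one]
        refine add_le_add ?_ ?_
        · refine (le_abs_self _).trans ?_
          rw [abs_mul]
          exact (mul_le_mul hy (h1.trans h2) (abs_nonneg _) ht.le).trans_eq (mul_one t)
        · have h3 : y ^ 2 ≤ t ^ 2 := sq_le_sq' (abs_le.1 hy).1 (abs_le.1 hy).2
          exact (mul_le_mul (mul_le_mul_of_nonneg_left h3 hB.le) h2 (erwsMoves_nonneg _ _)
            (by positivity)).trans_eq (mul_one _)
      refine (integral_mono_ae (hX.integrable_exp hpqr 1 _ _) (integrable_const _) hle).trans_eq ?_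
      simp
    | succ n hn ih =>
      have hn0 : (0 : ℝ) < n := by exact_mod_cast hn
      refine le_trans (hX.integral_exp_succ_le hpqr hn ha.le ?_ ?_) ih
      · rw [erwsNorm_succ _ hn]
        have := (hpos n).ne'
        have : (1 + (p - q) / n : ℝ) ≠ 0 := by positivity
        field_simp
      · have hb : |y / erwsNorm (p - q) (n + 1)| ≤ t := by
          rw [abs_div, abs_of_pos (hpos _)]
          exact (div_le_self (abs_nonneg y) (one_le_erwsNorm ha.le _)).trans hy
        refine ge_iff_le.2 ((h _ hb).trans ?_)
        have hx : y / erwsNorm (p - q) n =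
            y / erwsNorm (p - q) (n + 1) * (1 + (p - q) / n) := by
          rw [erwsNorm_succ _ hn]
          have := (hpos n).ne'
          have : (1 + (p - q) / n : ℝ) ≠ 0 := by positivity
          field_simp
        rw [hx]
        generalize y / erwsNorm (p - q) (n + 1) = z
        -- The decay of the compensator supplies the required 2a · B z^2 plus a nonnegative
        -- remainder.
        have : n * (B * (z * (1 + (p - q) / n)) ^ 2 - B * z ^ 2) =
            2 * (p - q) * (B * z ^ 2) + B * z ^ 2 * (p - q) ^ 2 / n := by
          field_simp; ring
        rw [this]
        have : 0 ≤ B * z ^ 2 * (p - q) ^ 2 / n := by positivity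
        linarith
  refine le_trans (integral_mono_of_nonneg ?_ (hX.integrable_exp hpqr n _ _) ?_) (hmono n hn)
  · exact Eventually.of_forall fun ω => (Real.exp_pos _).le
  · refine Eventually.of_forall fun ω => ?_
    simp only
    rw [Real.exp_le_exp]
    have : 0 ≤ B * (y / erwsNorm (p - q) n) ^ 2 * erwsMoves X n ω :=
      mul_nonneg (by positivity) (erwsMoves_nonneg _ _)
    have h2 : y * (erwsPosition X n ω / erwsNorm (p - q) n) =
      y / erwsNorm (p - q) n * erwsPosition X n ω := by ring
    linarith

lemma memLp_normalized [IsProbabilityMeasure μ] (hX : IsERWS μ p q r s X)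
    (hpqr : p + q + r = 1) (n : ℕ) (c : ℝ) (k : ENNReal) :
    MemLp (fun ω => erwsPosition X n ω / c) k μ := by
  refine MemLp.of_bound ((hX.measurable_position n).div_const c).aestronglyMeasurable (n / |c|) ?_
  filter_upwards [hX.ae_mem_values hpqr] with ω hω
  rw [Real.norm_eq_abs, abs_div]
  exact div_le_div_of_nonneg_right ((abs_erwsPosition_le hω).trans (erwsMoves_le hω)) (abs_nonneg c)

/-- All moments of the normalized walk are bounded. -/
lemma exists_eLpNorm_bound [IsProbabilityMeasure μ] (hX : IsERWS μ p q r s X)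
    (hpqr : p + q + r = 1) (ha : 0 < p - q) (hr : r < 1) (had : 1 - r < 2 * (p - q))
    {k : ℕ} (hk : k ≠ 0) :
    ∃ C : NNReal, ∀ n : ℕ, 1 ≤ n →
      eLpNorm (fun ω => erwsPosition X n ω / erwsNorm (p - q) n) k μ ≤ C := by
  obtain ⟨t, C, ht, h⟩ := hX.exists_exp_moment_bound hpqr ha hr had
  -- From (t|z|)^k / k! ≤ e^{t|z|} ≤ e^{tz} + e^{-tz}, each exponential having mean at most `C`.
  refine ⟨Real.toNNReal ((k.factorial / t ^ k * (C + C)) ^ (k : ℝ)⁻¹), fun n hn => ?_⟩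
  have hmem := hX.memLp_normalized hpqr n (erwsNorm (p - q) n) k
  have hk' : (0 : ℝ) < k := by exact_mod_cast Nat.pos_of_ne_zero hk
  rw [hmem.eLpNorm_eq_integral_rpow_norm (by exact_mod_cast hk) (ENNReal.natCast_ne_top k)]
  refine ENNReal.ofReal_le_ofReal (Real.rpow_le_rpow
    (integral_nonneg fun ω => Real.rpow_nonneg (norm_nonneg _) _) ?_ (by simp))
  have hint : ∀ y : ℝ, Integrable
      (fun ω => Real.exp (y * (erwsPosition X n ω / erwsNorm (p - q) n))) μ := by
    intro y
    refine (hX.integrable_exp hpqr n (y / erwsNorm (p - q) n) 0).congr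
      (Eventually.of_forall fun ω => ?_)
    simp only
    congr 1; ring
  calc _ ≤ ∫ ω, k.factorial / t ^ k * (Real.exp (t * (erwsPosition X n ω / erwsNorm (p - q) n)) +
        Real.exp (-t * (erwsPosition X n ω / erwsNorm (p - q) n))) ∂μ := by
        refine integral_mono_of_nonneg
          (Eventually.of_forall fun ω => Real.rpow_nonneg (norm_nonneg _) _)
          (((hint t).add (hint (-t))).const_mul _) (Eventually.of_forall fun ω => ?_)
        simp only [ENNReal.toReal_natCast, Real.rpow_natCast, Real.norm_eq_abs]
        generalize erwsPosition X n ω / erwsNorm (p - q) n = z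
        have h1 := Real.pow_div_factorial_le_exp _ (mul_nonneg ht.le (abs_nonneg z)) k
        have h2 : Real.exp (t * |z|) ≤ Real.exp (t * z) + Real.exp (-t * z) := by
          rcases abs_choice z with hz | hz <;> rw [hz]
          · linarith [Real.exp_pos (-t * z)]
          · rw [mul_neg, ← neg_mul]; linarith [Real.exp_pos (t * z)]
        have hf : (0 : ℝ) < k.factorial := by exact_mod_cast k.factorial_pos
        have h3 := h1.trans h2
        rw [mul_pow, div_le_iff₀ hf] at h3
        rw [div_mul_eq_mul_div, le_div_iff₀ (by positivity)]
        linarith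
    _ ≤ _ := by
        rw [integral_const_mul, integral_add (hint t) (hint (-t))]
        exact mul_le_mul_of_nonneg_left (add_le_add (h n hn t (abs_of_pos ht).le)
          (h n hn (-t) (by rw [abs_neg, abs_of_pos ht]))) (by positivity)

end IsERWS

/-! ### Uniform integrability and convergence in L^m -/

/-- A sequence bounded in `L^(2 * m)` is uniformly integrable in `L^m`. -/
lemma unifIntegrable_of_eLpNorm_two_mul_le {Ω : Type*} [MeasurableSpace Ω] {μ : Measure Ω}
    {f : ℕ → Ω → ℝ} {m : ℕ} (hm : 1 ≤ m) (hf : ∀ n, AEStronglyMeasurable (f n) μ) {C : NNReal}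
    (hC : ∀ n, eLpNorm (f n) ((2 * m : ℕ) : ENNReal) μ ≤ C) :
    UnifIntegrable f (m : ENNReal) μ := by
  refine unifIntegrable_of (by exact_mod_cast hm) (ENNReal.natCast_ne_top m) hf fun ε hε => ?_
  -- On {|f| ≥ K} one has |f| ≤ |f|^2 / K, so the tail has L^m norm at most C^2 / K, which this K
  -- makes at most ε.
  have hK : 0 < (C : ℝ) ^ 2 / ε + 1 := by positivity
  obtain ⟨K, hKdef⟩ : ∃ K : NNReal, (K : ℝ) = (C : ℝ) ^ 2 / ε + 1 := ⟨⟨_, hK.le⟩, rfl⟩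
  refine ⟨K, fun n => ?_⟩
  have hKpos : (0 : ℝ) < K := hKdef ▸ hK
  have h1 : eLpNorm (Set.indicator {x | K ≤ ‖f n x‖₊} (f n)) m μ ≤
      eLpNorm (fun x => (K : ℝ)⁻¹ • ‖f n x‖ ^ (2 : ℝ)) m μ := by
    refine eLpNorm_mono_real fun x => ?_
    by_cases hx : x ∈ {x | K ≤ ‖f n x‖₊}
    · rw [Set.indicator_of_mem hx]
      have hx' : (K : ℝ) ≤ ‖f n x‖ := hx
      rw [smul_eq_mul, ← div_eq_inv_mul, le_div_iff₀ hKpos, Real.rpow_two, sq]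
      exact mul_le_mul_of_nonneg_left hx' (norm_nonneg _)
    · rw [Set.indicator_of_notMem hx, norm_zero]
      positivity
  refine h1.trans ?_
  have h2 := eLpNorm_const_smul (K : ℝ)⁻¹ (fun x => ‖f n x‖ ^ (2 : ℝ)) (m : ENNReal) μ
  have h3 := eLpNorm_norm_rpow (μ := μ) (p := m) (f n) (q := 2) two_pos
  have h4 : (m : ENNReal) * ENNReal.ofReal 2 = ((2 * m : ℕ) : ENNReal) := by
    push_cast; rw [mul_comm]; simp
  rw [h4] at h3
  refine h2.trans_le ?_
  rw [h3, ← ofReal_norm, Real.norm_of_nonneg (by positivity)]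
  calc _ ≤ ENNReal.ofReal (K : ℝ)⁻¹ * (C : ENNReal) ^ (2 : ℝ) := by
        gcongr; exact hC n
    _ = ENNReal.ofReal ((K : ℝ)⁻¹ * (C : ℝ) ^ 2) := by
        rw [ENNReal.ofReal_mul (by positivity), ENNReal.ofReal_pow (by positivity)]
        simp
    _ ≤ ENNReal.ofReal ε := by
        refine ENNReal.ofReal_le_ofReal ?_
        rw [← div_eq_inv_mul, div_le_iff₀ hKpos, hKdef, mul_add, mul_div_cancel₀ _ hε.ne']
        linarith

/-- Convergence in `L^m` in terms of the `m`-th absolute moment. -/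
lemma tendsto_integral_abs_pow_of_eLpNorm {Ω : Type*} [MeasurableSpace Ω] {μ : Measure Ω}
    {f : ℕ → Ω → ℝ} {m : ℕ} (hm : 1 ≤ m) (hf : ∀ n, MemLp (f n) m μ)
    (h : Tendsto (fun n => eLpNorm (f n) m μ) atTop (𝓝 0)) :
    Tendsto (fun n => ∫ ω, |f n ω| ^ m ∂μ) atTop (𝓝 0) := by
  have hm0 : m ≠ 0 := by omega
  have h1 : ∀ n, ∫ ω, |f n ω| ^ m ∂μ = (eLpNorm (f n) m μ).toReal ^ m := by
    intro n
    have hnn : 0 ≤ ∫ ω, |f n ω| ^ m ∂μ := integral_nonneg fun ω => by positivity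
    rw [(hf n).eLpNorm_eq_integral_rpow_norm (by exact_mod_cast hm0) (ENNReal.natCast_ne_top m)]
    simp only [ENNReal.toReal_natCast, Real.rpow_natCast, Real.norm_eq_abs]
    rw [ENNReal.toReal_ofReal (Real.rpow_nonneg hnn _), Real.rpow_inv_natCast_pow hnn hm0]
  simp_rw [h1]
  have := ((ENNReal.tendsto_toReal ENNReal.zero_ne_top).comp h).pow m
  simpa [hm0] using this

/-! ### The martingale and its limit -/

namespace IsERWS

variable {Ω : Type*} [MeasurableSpace Ω] {μ : Measure Ω} {p q r s : ℝ} {X : ℕ → Ω → ℝ}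

/-- The filtration generated by the steps; the `n`-th σ-algebra is that of `X 1, …, X (n + 1)`. -/
noncomputable def filtration (hX : IsERWS μ p q r s X) :
    Filtration ℕ (inferInstance : MeasurableSpace Ω) :=
  Filtration.natural (fun n => X (n + 1)) fun n => (hX.measurable (n + 1)).stronglyMeasurable

/-- The normalized walk is a martingale. -/
lemma martingale [IsProbabilityMeasure μ] (hX : IsERWS μ p q r s X)
    (hpqr : p + q + r = 1) (ha : 0 ≤ p - q) :
    Martingale (fun n ω => erwsPosition X (n + 1) ω / erwsNorm (p - q) (n + 1))
      hX.filtration μ := by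
  have hint : ∀ n c, Integrable (fun ω => erwsPosition X n ω / c) μ := fun n c =>
    (hX.memLp_normalized hpqr n c 1).integrable le_rfl
  have hXint : ∀ n, Integrable (X n) μ := by
    intro n
    refine Integrable.of_bound (C := 1) (hX.measurable n).aestronglyMeasurable ?_
    filter_upwards [hX.ae_mem_values hpqr] with ω hω
    exact abs_le_one_of_mem_erwsValues (hω n)
  refine martingale_of_setIntegral_eq_succ ?_ (fun n => hint _ _) fun n A hA => ?_
  · intro n
    refine Measurable.stronglyMeasurable (Measurable.div_const
      (Finset.measurable_sum _ fun k hk => ?_) _)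
    obtain ⟨hk1, hk2⟩ := Finset.mem_Icc.1 hk
    obtain ⟨j, rfl⟩ := Nat.exists_eq_add_of_le' hk1
    have := (Filtration.stronglyAdapted_natural (u := fun n => X (n + 1)) fun n =>
      (hX.measurable (n + 1)).stronglyMeasurable) j
    exact this.measurable.mono (hX.filtration.mono (by omega)) le_rfl
  · have hA' := hX.filtration.le n _ hA
    have hcomap := Filtration.natural_eq_comap (fun n => X (n + 1))
      (fun n => (hX.measurable (n + 1)).stronglyMeasurable) n
    rw [filtration, hcomap] at hA
    obtain ⟨D, -, rfl⟩ := hA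
    set A := (fun ω (j : Set.Iic n) => X (j + 1) ω) ⁻¹' D with hAdef
    -- For `g` the identity the even part vanishes, so on any event of the past the next step
    -- integrates like a S / (n + 1), S being the position at time n + 1.
    have key := hX.integral_mul_step hpqr (Nat.le_add_left 1 n)
      (F := fun y => D.indicator (fun _ => 1) (fun j : Set.Iic n => y (j + 1))) (by
        intro y z h
        have : (fun j : Set.Iic n => y (j + 1)) = fun j : Set.Iic n => z (j + 1) := by
          funext j
          refine h _ ?_
          have := j.2
          simp only [Set.mem_Iic, Finset.coe_Icc, Set.mem_Icc] at this ⊢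
          omega
        simp only [this]) (fun e => e)
    have hind : ∀ f : Ω → ℝ, ∫ ω, D.indicator (fun _ => (1 : ℝ))
        (fun j : Set.Iic n => X (j + 1) ω) * f ω ∂μ = ∫ ω in A, f ω ∂μ := by
      intro f
      rw [← integral_indicator hA']
      refine integral_congr_ae (Eventually.of_forall fun ω => ?_)
      by_cases hω : ω ∈ A
      · simp only [Set.indicator_of_mem hω]
        rw [Set.indicator_of_mem (by exact hω), one_mul]
      · simp only [Set.indicator_of_notMem hω]
        rw [Set.indicator_of_notMem (by exact hω), zero_mul]
    rw [hind, hind] at key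
    have hN := erwsNorm_pos ha (n + 1)
    have hn0 : (0 : ℝ) < ((n + 1 : ℕ) : ℝ) := by positivity
    have h1 : (0 : ℝ) < 1 + (p - q) / (n + 1 : ℕ) := by positivity
    have h2 : ∫ ω in A, erwsPosition X (n + 1 + 1) ω ∂μ =
        (∫ ω in A, erwsPosition X (n + 1) ω ∂μ) * (1 + (p - q) / (n + 1 : ℕ)) := by
      simp_rw [erwsPosition_succ X (n + 1)]
      have hi : Integrable (erwsPosition X (n + 1)) μ := by simpa using hint (n + 1) 1
      rw [integral_add hi.integrableOn (hXint _).integrableOn, key, mul_add, mul_one,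
        ← integral_mul_const]
      congr 1
      refine integral_congr_ae (Eventually.of_forall fun ω => ?_)
      simp only [erwsPosition]
      ring
    rw [integral_div, integral_div, h2, erwsNorm_succ _ (Nat.le_add_left 1 n)]
    field_simp

end IsERWS

namespace IsERWS

variable {Ω : Type*} [MeasurableSpace Ω] {μ : Measure Ω} {p q r s : ℝ} {X : ℕ → Ω → ℝ}

/-- The normalized walk converges almost surely. -/
lemma exists_ae_tendsto_normalized [IsProbabilityMeasure μ] (hX : IsERWS μ p q r s X)
    (hpqr : p + q + r = 1) (ha : 0 < p - q) (hr : r < 1) (had : 1 - r < 2 * (p - q)) :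
    ∃ Z : Ω → ℝ, Measurable Z ∧ ∀ᵐ ω ∂μ,
      Tendsto (fun n => erwsPosition X n ω / erwsNorm (p - q) n) atTop (𝓝 (Z ω)) := by
  obtain ⟨C, hC⟩ := hX.exists_eLpNorm_bound hpqr ha hr had one_ne_zero
  rw [Nat.cast_one] at hC
  refine measurable_limit_of_tendsto_metrizable_ae
    (fun n => ((hX.measurable_position n).div_const _).aemeasurable) ?_
  filter_upwards [(hX.martingale hpqr ha.le).submartingale.exists_ae_tendsto_of_bdd
    fun n => hC (n + 1) (Nat.le_add_left 1 n)] with ω ⟨c, hc⟩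
  exact ⟨c, (tendsto_add_atTop_iff_nat
    (f := fun n => erwsPosition X n ω / erwsNorm (p - q) n) 1).1 hc⟩

section Superdiffusive

variable [IsProbabilityMeasure μ] {Z : Ω → ℝ}

/-- Fatou's lemma applied to the uniform L^m bound. -/
lemma memLp_limit (hX : IsERWS μ p q r s X)
    (hpqr : p + q + r = 1) (ha : 0 < p - q) (hr : r < 1) (had : 1 - r < 2 * (p - q))
    (hZm : Measurable Z) (hZ : ∀ᵐ ω ∂μ,
      Tendsto (fun n => erwsPosition X n ω / erwsNorm (p - q) n) atTop (𝓝 (Z ω)))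
    {m : ℕ} (hm : 1 ≤ m) : MemLp Z m μ := by
  obtain ⟨C, hC⟩ := hX.exists_eLpNorm_bound hpqr ha hr had (k := m) (by omega)
  refine ⟨hZm.aestronglyMeasurable, (Lp.eLpNorm_le_of_ae_tendsto (C := C) ?_ (fun n =>
    ((hX.measurable_position n).div_const _).aestronglyMeasurable) hZ).trans_lt
      ENNReal.coe_lt_top⟩
  filter_upwards [eventually_ge_atTop 1] with n hn using hC n hn

/-- The L^2 bound gives uniform integrability, so the martingale converges in L^1 and is closed by
its limit. -/
lemma normalized_ae_eq_condExp_limit (hX : IsERWS μ p q r s X)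
    (hpqr : p + q + r = 1) (ha : 0 < p - q) (hr : r < 1) (had : 1 - r < 2 * (p - q))
    (hZm : Measurable Z) (hZ : ∀ᵐ ω ∂μ,
      Tendsto (fun n => erwsPosition X n ω / erwsNorm (p - q) n) atTop (𝓝 (Z ω))) (n : ℕ) :
    (fun ω => erwsPosition X (n + 1) ω / erwsNorm (p - q) (n + 1)) =ᵐ[μ]
      μ[Z | hX.filtration n] := by
  have hmeas : ∀ n, AEStronglyMeasurable
      (fun ω => erwsPosition X (n + 1) ω / erwsNorm (p - q) (n + 1)) μ := fun n =>
    ((hX.measurable_position _).div_const _).aestronglyMeasurable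
  obtain ⟨D, hD⟩ := hX.exists_eLpNorm_bound hpqr ha hr had (k := 2 * 1) (by norm_num)
  have hunif := unifIntegrable_of_eLpNorm_two_mul_le le_rfl hmeas
    fun n => hD (n + 1) (Nat.le_add_left 1 n)
  have hZ1 := hX.memLp_limit hpqr ha hr had hZm hZ le_rfl
  rw [Nat.cast_one] at hunif hZ1
  refine (hX.martingale hpqr ha.le).eq_condExp_of_tendsto_eLpNorm (hZ1.integrable le_rfl)
    (tendsto_Lp_finite_of_tendsto_ae le_rfl ENNReal.one_ne_top hmeas hZ1 hunif ?_) n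
  filter_upwards [hZ] with ω hω using hω.comp (tendsto_add_atTop_nat 1)

/-- If Z = c, closedness makes every martingale term equal c, so X_1 = c and X_2 = (p - q) c. A stop
at time 2 has positive probability, forcing c = 0, whereas X_1 is ±1. Using the second step covers s
= 0 and s = 1, where X_1 is itself deterministic. -/
lemma limit_not_ae_const (hX : IsERWS μ p q r s X) (hq : 0 ≤ q) (hr0 : 0 < r)
    (hpqr : p + q + r = 1) (ha : 0 < p - q) (hr : r < 1) (had : 1 - r < 2 * (p - q))
    (hZm : Measurable Z) (hZ : ∀ᵐ ω ∂μ,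
      Tendsto (fun n => erwsPosition X n ω / erwsNorm (p - q) n) atTop (𝓝 (Z ω))) (c : ℝ) :
    ¬ ∀ᵐ ω ∂μ, Z ω = c := by
  intro hc
  have hM : ∀ n, ∀ᵐ ω ∂μ, erwsPosition X (n + 1) ω / erwsNorm (p - q) (n + 1) = c := by
    intro n
    have h1 : Z =ᵐ[μ] fun _ => c := hc
    have h2 := (hX.normalized_ae_eq_condExp_limit hpqr ha hr had hZm hZ n).trans
      (condExp_congr_ae (m := hX.filtration n) h1)
    rwa [condExp_const (hX.filtration.le n)] at h2
  have hX1 : ∀ᵐ ω ∂μ, X 1 ω = c := by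
    filter_upwards [hM 0] with ω hω
    simpa [erwsPosition, erwsNorm_one] using hω
  have hX2 : ∀ᵐ ω ∂μ, X 2 ω = (p - q) * c := by
    filter_upwards [hM 1, hX1] with ω hω h1
    rw [erwsPosition_succ, erwsNorm_succ _ le_rfl, erwsNorm_one,
      div_eq_iff (by rw [Nat.cast_one, div_one]; positivity)] at hω
    simp only [erwsPosition, Finset.Icc_self, Finset.sum_singleton, h1, Nat.cast_one] at hω
    linear_combination hω
  have hstep := hX.step 1 le_rfl (fun _ => c) 0
  have hpast : μ.real {ω | ∀ k ∈ Finset.Icc 1 1, X k ω = c} = 1 := by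
    rw [measureReal_def, ENNReal.toReal_eq_one_iff]
    refine (mem_ae_iff_prob_eq_one (hX.measurableSet_past 1 fun _ => c)).1 ?_
    filter_upwards [hX1] with ω hω
    simpa using hω
  have hprob : 0 < erwsStepProb p q r 1 (fun _ => c) 0 := by
    simp only [erwsStepProb, Finset.Icc_self, Finset.sum_singleton, if_true]
    split_ifs <;> norm_num <;> linarith
  rw [hpast, one_mul] at hstep
  have hc0 : c = 0 := by
    by_contra hne
    have : μ.real {ω | (∀ k ∈ Finset.Icc 1 1, X k ω = c) ∧ X (1 + 1) ω = 0} = 0 := by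
      rw [measureReal_eq_zero_iff]
      refine measure_mono_null (fun ω hω => ?_) (ae_iff.1 hX2)
      intro h
      exact mul_ne_zero ha.ne' hne (h.symm.trans hω.2)
    linarith
  have hnull : ∀ e : ℝ, e ≠ 0 → μ.real {ω | X 1 ω = e} = 0 := by
    intro e he
    rw [measureReal_eq_zero_iff]
    refine measure_mono_null (fun ω (hω : X 1 ω = e) => ?_) (ae_iff.1 hX1)
    intro h
    exact he (hω.symm.trans (h.trans hc0))
  have h1 := hX.first_pos
  have h2 := hX.first_neg
  rw [hnull _ (by norm_num)] at h1 h2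
  linarith

lemma exists_eLpNorm_div_rpow_bound (hX : IsERWS μ p q r s X)
    (hpqr : p + q + r = 1) (ha : 0 < p - q) (hr : r < 1) (had : 1 - r < 2 * (p - q))
    {k : ℕ} (hk : k ≠ 0) :
    ∃ C : NNReal, ∀ n : ℕ,
      eLpNorm (fun ω => erwsPosition X n ω / (n : ℝ) ^ (p - q)) k μ ≤ C := by
  obtain ⟨C, hC⟩ := hX.exists_eLpNorm_bound hpqr ha hr had hk
  obtain ⟨D, hD⟩ := (tendsto_erwsNorm_div_rpow ha).bddAbove_range
  refine ⟨Real.toNNReal D * C, fun n => ?_⟩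
  rcases Nat.eq_zero_or_pos n with rfl | hn
  · simp [erwsPosition]
  have hN := erwsNorm_pos ha.le n
  have h0 : 0 ≤ erwsNorm (p - q) n / (n : ℝ) ^ (p - q) := by positivity
  have h1 : (fun ω => erwsPosition X n ω / (n : ℝ) ^ (p - q)) =
      (erwsNorm (p - q) n / (n : ℝ) ^ (p - q)) •
        fun ω => erwsPosition X n ω / erwsNorm (p - q) n := by
    funext ω
    simp only [Pi.smul_apply, smul_eq_mul]
    field_simp
  rw [h1, eLpNorm_const_smul, ← ofReal_norm, Real.norm_of_nonneg h0, ENNReal.coe_mul]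
  exact mul_le_mul' (ENNReal.ofReal_le_ofReal (hD ⟨n, rfl⟩)) (hC n hn)

end Superdiffusive

end IsERWS

theorem theorem3p7 {Ω : Type*} [MeasurableSpace Ω] (μ : Measure Ω) [IsProbabilityMeasure μ]
    (p q r s : ℝ) (hp : 0 ≤ p) (hq : 0 ≤ q) (hr0 : 0 < r) (hr1 : r < 1) (hpqr : p + q + r = 1)
    (hs0 : 0 ≤ s) (hs1 : s ≤ 1) (hsuper : 3 / 4 < p / (1 - r))
    (X : ℕ → Ω → ℝ) (hX : IsERWS μ p q r s X) :
    ∃ L : Ω → ℝ, Measurable L ∧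
      (∀ᵐ ω ∂μ, Tendsto (fun n : ℕ => erwsPosition X n ω / (n : ℝ) ^ (2 * p + r - 1))
        atTop (𝓝 (L ω))) ∧
      (¬ ∃ c : ℝ, ∀ᵐ ω ∂μ, L ω = c) ∧
      ∀ m : ℕ, 1 ≤ m →
        MemLp L (m : ENNReal) μ ∧
        (∀ n : ℕ, Integrable
          (fun ω => |erwsPosition X n ω / (n : ℝ) ^ (2 * p + r - 1) - L ω| ^ m) μ) ∧
        Tendsto
          (fun n : ℕ => ∫ ω, |erwsPosition X n ω / (n : ℝ) ^ (2 * p + r - 1) - L ω| ^ m ∂μ)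
          atTop (𝓝 0) := by
  have hexp : 2 * p + r - 1 = p - q := by linarith
  -- With p + q = 1 - r the hypothesis reads p > 3q, equivalently 1 - r < 2 (p - q).
  rw [lt_div_iff₀ (sub_pos.2 hr1)] at hsuper
  have ha : 0 < p - q := by linarith
  have had : 1 - r < 2 * (p - q) := by linarith
  rw [hexp]
  obtain ⟨c, hcdef⟩ : ∃ c, c = ((p - q) * Real.Gamma (p - q))⁻¹ := ⟨_, rfl⟩
  have hc : 0 < c := hcdef ▸ inv_pos.2 (mul_pos ha (Real.Gamma_pos_of_pos ha))
  obtain ⟨Z, hZm, hZ⟩ := hX.exists_ae_tendsto_normalized hpqr ha hr1 had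
  have hlim : ∀ᵐ ω ∂μ, Tendsto (fun n : ℕ => erwsPosition X n ω / (n : ℝ) ^ (p - q))
      atTop (𝓝 (c * Z ω)) := by
    filter_upwards [hZ] with ω hω
    have := tendsto_erwsNorm_div_rpow ha
    rw [← hcdef] at this
    refine (this.mul hω).congr fun n => ?_
    have := (erwsNorm_pos ha.le n).ne'
    field_simp
  refine ⟨fun ω => c * Z ω, hZm.const_mul c, hlim, ?_, fun m hm => ?_⟩
  · rintro ⟨b, hb⟩
    refine hX.limit_not_ae_const hq hr0 hpqr ha hr1 had hZm hZ (b / c) ?_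
    filter_upwards [hb] with ω hω
    rw [eq_div_iff hc.ne', mul_comm, hω]
  · have hL : MemLp (fun ω => c * Z ω) m μ :=
      (hX.memLp_limit hpqr ha hr1 had hZm hZ hm).const_mul c
    have hS : ∀ n : ℕ, MemLp (fun ω => erwsPosition X n ω / (n : ℝ) ^ (p - q)) m μ :=
      fun n => hX.memLp_normalized hpqr n _ m
    have hD : ∀ n : ℕ, MemLp
        (fun ω => erwsPosition X n ω / (n : ℝ) ^ (p - q) - c * Z ω) m μ :=
      fun n => (hS n).sub hL
    refine ⟨hL, fun n => (hD n).integrable_norm_pow (by omega), ?_⟩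
    refine tendsto_integral_abs_pow_of_eLpNorm hm hD ?_
    obtain ⟨C, hC⟩ := hX.exists_eLpNorm_div_rpow_bound hpqr ha hr1 had (k := 2 * m) (by omega)
    exact tendsto_Lp_finite_of_tendsto_ae (by exact_mod_cast hm) (ENNReal.natCast_ne_top m)
      (fun n => (hS n).1) hL
      (unifIntegrable_of_eLpNorm_two_mul_le hm (fun n => (hS n).1) hC) hlim
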